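/- Let $(\mathcal X,\mathcal A)$ be a measurable space. For probability measures $P,Q$ on it and $\alpha\in[0,1]$ let $T(P,Q)(\alpha)=\inf\{E_Q[1-\varphi]:\varphi:\mathcal X\to[0,1]\text{ measurable},\ E_P[\varphi]\le\alpha\}$. A trade-off function is a convex, continuous, non-increasing $f:[0,1]\to[0,1]$ with $f(\alpha)\le 1-\alpha$. Let $\mathcal S\subseteq\mathcal A$ have VC dimension $d=\mathrm{VC}(\mathcal S)<\infty$, where $\mathrm{VC}(\mathcal S)$ is the supremum of $|A|$ over the finite sets $A\subseteq\mathcal X$ with $\{A\cap S:S\in\mathcal S\}=2^A$. Assume that for all $m$ and $I\subseteq\{1,\dots,m\}$ the event $\{x\in\mathcal X^m:\exists S\in\mathcal S\ \forall i\ (x_i\in S\Leftrightarrow i\in I)\}$ is universally measurable, i.e. measurable up to a null set for every probability measure on $\mathcal X^m$. Let $n\ge1$, $\delta\in(0,1)$, and put $$\tau=\frac{4\,[d\log(2n)+\log(32/\delta)]}{n},\quad V(t)=\min\{t,(1-t)_+\},\quad h_+(t)=\min\{t+\sqrt{\tau V(t)}+\tau,\,1\},$$ $$h_+^{\leftarrow}(t)=\inf\{s\in[0,1]:h_+(s)\ge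 t\}.$$ Let $f_0$ be a trade-off function. For samples $X_{1:n},Y_{1:n}$ with empirical measures $P_n,Q_n$, let the test $\psi_{n,\delta}\in\{0,1\}$ be $1$ if and only if $h_+(Q_n(S^{\mathsf c}))<f_0(h_+(P_n(S)))$ for some $S\in\mathcal S$. Then the following hold. (i) Type I error (no attainability assumed): $$\sup_{(P,Q):\ T(P,Q)\ge f_0\text{ on }[0,1]}(P^n\times Q^n)(\psi_{n,\delta}=1)\le\delta,$$ where the supremum is over all pairs of probability measures on $\mathcal X$. (ii) Type II error: call $(P,Q)$ $\mathcal S$-attainable if $\emptyset,\mathcal X\in\mathcal S$ and, with $\mu=(P+Q)/2$, $p=dP/d\mu$, $q=dQ/d\mu$, for every $\lambda\in[0,\infty]$ there is $S\in\mathcal S$ with $\mathbf 1_S=\mathbf 1_{\{q>\lambda p\}}$ $\mu$-a.e., where for $\lambda=\infty$ the set $\{q>\lambda p\}$ is read as $\{p=0\}$. If $f_1$ is a trade-off function with $f_1(\alpha)\le (h_+^{\leftarrow}\circ h_+^{\leftarrow}\circ f_0\circ h_+\circ h_+)(\alpha)$ for all $\alpha\in[0,1]$, then $$\sup(P^n\times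 Q^n)(\psi_{n,\delta}=0)\le\delta,$$ where the supremum is over all $\mathcal S$-attainable pairs $(P,Q)$ with $T(P,Q)(\alpha)<f_1(\alpha)$ for some $\alpha\in[0,1]$. -/

import Mathlib

open MeasureTheory Set
open scoped ENNReal

namespace TradeoffTesting

noncomputable section

/-! ### Trade-off functions -/

/-- A (randomized) test: a measurable function with values in `[0,1]`. -/
def IsTest {X : Type*} [MeasurableSpace X] (φ : X → ℝ) : Prop :=
  Measurable φ ∧ ∀ x, φ x ∈ Icc (0 : ℝ) 1

/-- The trade-off function `T(P,Q)(α) = inf { E_Q[1 - φ] : φ a test with E_P[φ] ≤ α }`. For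
`α ≥ 0` the set below is non-empty (take `φ = 0`) and bounded below by `0`. -/
def tradeoff {X : Type*} [MeasurableSpace X] (P Q : ProbabilityMeasure X) (α : ℝ) : ℝ :=
  sInf {β : ℝ | ∃ φ : X → ℝ, IsTest φ ∧ ∫ x, φ x ∂(P : Measure X) ≤ α ∧
    β = ∫ x, (1 - φ x) ∂(Q : Measure X)}

/-- A benchmark trade-off function on `[0,1]`: it maps `[0,1]` into `[0,1]` and is convex,
continuous, non-increasing and at most `1 - α`. Values outside `[0,1]` are irrelevant. -/
structure IsBenchmark (f : ℝ → ℝ) : Prop where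
  mapsTo : MapsTo f (Icc 0 1) (Icc 0 1)
  convexOn : ConvexOn ℝ (Icc 0 1) f
  continuousOn : ContinuousOn f (Icc 0 1)
  antitoneOn : AntitoneOn f (Icc 0 1)
  le_one_sub : ∀ α ∈ Icc (0 : ℝ) 1, f α ≤ 1 - α

/-! ### VC dimension -/

/-- The finite set `A` is shattered by the set class `𝒮`: all `2 ^ #A` subsets of `A` are of the
form `A ∩ S` with `S ∈ 𝒮`. -/
def Shatters {X : Type*} (𝒮 : Set (Set X)) (A : Finset X) : Prop :=
  ∀ B : Set X, B ⊆ (A : Set X) → ∃ S ∈ 𝒮, (A : Set X) ∩ S = B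

/-- The Vapnik-Chervonenkis dimension, `⊤` if arbitrarily large finite sets are shattered. -/
def vcDim {X : Type*} (𝒮 : Set (Set X)) : ℕ∞ :=
  ⨆ A ∈ {A : Finset X | Shatters 𝒮 A}, (A.card : ℕ∞)

/-! ### Attainability -/

/-- The likelihood-ratio level set `{q > l p}` for `l ∈ [0,∞]`, which is `{p = 0}` for `l = ∞`. -/
def levelSet {X : Type*} (p q : X → ℝ≥0∞) (l : ℝ≥0∞) : Set X :=
  if l = ⊤ then {x | p x = 0} else {x | l * p x < q x}

/-- `(P,Q)` is `𝒮`-attainable: `∅` and the whole space belong to `𝒮` and, with `μ = (P+Q)/2`,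
`p = dP/dμ`, `q = dQ/dμ`, each level set `{q > l p}`, `l ∈ [0,∞]`, is `μ`-a.e. equal to a member
of `𝒮`. -/
def Attainable {X : Type*} [MeasurableSpace X] (𝒮 : Set (Set X))
    (P Q : ProbabilityMeasure X) : Prop :=
  ∅ ∈ 𝒮 ∧ univ ∈ 𝒮 ∧
    let μ : Measure X := (2⁻¹ : ℝ≥0∞) • ((P : Measure X) + (Q : Measure X))
    ∀ l : ℝ≥0∞, ∃ S ∈ 𝒮,
      S =ᵐ[μ] levelSet ((P : Measure X).rnDeriv μ) ((Q : Measure X).rnDeriv μ) l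

/-- The collection `ℳ_𝒮` of all `𝒮`-attainable pairs. -/
def attainablePairs {X : Type*} [MeasurableSpace X] (𝒮 : Set (Set X)) :
    Set (ProbabilityMeasure X × ProbabilityMeasure X) :=
  {PQ | Attainable 𝒮 PQ.1 PQ.2}

/-! ### Measurability of the scan -/

/-- For all finite sample sizes `m` and all patterns `I`, the event that some `S ∈ 𝒮` contains
exactly those sample points `x i` with `i ∈ I` is universally measurable, that is, measurable up
to null sets for each probability measure on `X ^ m`. This holds for instance if `𝒮` is a
countable class of measurable sets. It makes events that scan over the (possibly uncountable)
class `𝒮` measurable. -/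
def TraceMeasurable {X : Type*} [MeasurableSpace X] (𝒮 : Set (Set X)) : Prop :=
  ∀ (m : ℕ) (I : Set (Fin m)) (ν : Measure (Fin m → X)), IsProbabilityMeasure ν →
    NullMeasurableSet {x : Fin m → X | ∃ S ∈ 𝒮, ∀ i, x i ∈ S ↔ i ∈ I} ν

/-! ### The scan test -/

/-- The empirical probability `P_n(S) = (1/n) ∑ i, 1{x i ∈ S}`. -/
def empProb {X : Type*} {n : ℕ} (x : Fin n → X) (S : Set X) : ℝ :=
  (∑ i, S.indicator (fun _ => (1 : ℝ)) (x i)) / n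

/-- `τ_{n,δ} = 4 (VC(𝒮) log (2n) + log (32/δ)) / n`, with `d` the VC dimension. -/
def tau (d n : ℕ) (δ : ℝ) : ℝ :=
  4 * (d * Real.log (2 * n) + Real.log (32 / δ)) / n

/-- `V(t) = min {t, (1 - t)₊}`. -/
def V (t : ℝ) : ℝ := min t (max (1 - t) 0)

/-- The upper confidence map `h₊(t) = min {t + √(τ V(t)) + τ, 1}`. -/
def hUp (τ t : ℝ) : ℝ := min (t + √(τ * V t) + τ) 1

/-- The generalized inverse `h₊^←(t) = inf {s ∈ [0,1] : h₊(s) ≥ t}`. -/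
def hInv (τ t : ℝ) : ℝ := sInf {s : ℝ | s ∈ Icc (0 : ℝ) 1 ∧ t ≤ hUp τ s}

/-- The rejection region `{ψ = 1}` of the scan test: the samples `(x, y)` for which
`h₊(Q_n(Sᶜ)) < f₀(h₊(P_n(S)))` for some `S ∈ 𝒮`. -/
def scanTest {X : Type*} (𝒮 : Set (Set X)) (f₀ : ℝ → ℝ) (n : ℕ) (δ : ℝ) :
    Set ((Fin n → X) × (Fin n → X)) :=
  {z | ∃ S ∈ 𝒮, hUp (tau (vcDim 𝒮).toNat n δ) (empProb z.2 Sᶜ) <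
    f₀ (hUp (tau (vcDim 𝒮).toNat n δ) (empProb z.1 S))}

/-! ### Errors of a test -/

/-- The law `P^n × Q^n` of two independent i.i.d. samples. -/
def sampleLaw {X : Type*} [MeasurableSpace X] (n : ℕ) (P Q : ProbabilityMeasure X) :
    Measure ((Fin n → X) × (Fin n → X)) :=
  (Measure.pi fun _ : Fin n => (P : Measure X)).prod
    (Measure.pi fun _ : Fin n => (Q : Measure X))

/-- The worst-case type I error, over the pairs in `M` with `T(P,Q) ≥ f₀` on `[0,1]`, of the
test with rejection region `R`. -/
def errOne {X : Type*} [MeasurableSpace X] {n : ℕ}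
    (M : Set (ProbabilityMeasure X × ProbabilityMeasure X)) (f₀ : ℝ → ℝ)
    (R : Set ((Fin n → X) × (Fin n → X))) : ℝ≥0∞ :=
  ⨆ PQ ∈ {PQ ∈ M | ∀ α ∈ Icc (0 : ℝ) 1, f₀ α ≤ tradeoff PQ.1 PQ.2 α},
    sampleLaw n PQ.1 PQ.2 R

/-- The worst-case type II error, over the pairs in `M` with `T(P,Q)(α) < f₁(α)` for some
`α ∈ [0,1]`, of the test with rejection region `R`. -/
def errTwo {X : Type*} [MeasurableSpace X] {n : ℕ}
    (M : Set (ProbabilityMeasure X × ProbabilityMeasure X)) (f₁ : ℝ → ℝ)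
    (R : Set ((Fin n → X) × (Fin n → X))) : ℝ≥0∞ :=
  ⨆ PQ ∈ {PQ ∈ M | ∃ α ∈ Icc (0 : ℝ) 1, tradeoff PQ.1 PQ.2 α < f₁ α},
    sampleLaw n PQ.1 PQ.2 Rᶜ

end

end TradeoffTesting

/-!
The errors of the scan test are controlled by uniform confidence bands: each of the one-sided
statements `P S ≤ h₊(P_n S)` and `P_n S ≤ h₊(P S)` holds for all `S ∈ 𝒮` at once with probability
at least `1 - δ/2`, for `P` and `𝒮` as for `Q` and the class of complements
(`measure_exists_hUp_empProb_lt_le`, `measure_exists_hUp_lt_empProb_le`).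

Given the bands, the type I bound holds because the indicator of `S` is a test, so
`T(P,Q) ≥ f₀` gives `Q(Sᶜ) ≥ f₀(P S)`. For the type II bound, a pair with `T(P,Q)(α) < f₁ α` has
some `S ∈ 𝒮` with `Q(Sᶜ) < f₁(P S)` (`Attainable.exists_measureReal_compl_lt`): if `-l` is a
subgradient of the convex function `f₁` at `α`, the set `{q > l p}` minimizes the Lagrangian
`E_Q[1 - φ] + l E_P[φ]`, so if the errors of all such sets lay above `f₁`, all of `T(P,Q)` would.
Two applications of `s < h₊^←(t) → h₊(s) < t` turn `Q(Sᶜ) < f₁(P S)` into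
`h₊(h₊(Q(Sᶜ))) < f₀(h₊(h₊(P S)))`, and the bands replace the inner maps by empirical values.

The bands follow from Vapnik–Chervonenkis bounds for relative deviations. The additive term `τ` in
`h₊` leaves the count of an independent second sample some room around its mean, and a fourth moment
bound shows that it stays on the right side with probability at least `1/7`
(`one_div_seven_le_measureReal_sum`). This produces two samples whose counts differ by much
(`gapEvent`). That event is invariant in law under exchanges of paired points, so that
Hoeffding's inequality for random signs (`card_signs_le`), over the traces counted by the
Sauer–Shelah lemma (`card_traces_le`), bounds its probability by the growth function at `2n` times
`exp (-n τ / 4)`. The value of `τ` makes seven times this bound at most `δ/4`, and two such bounds,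
for `𝒮` and for its complements, give one band. Only `gapEvent` has to be measurable, up to null
sets; one-sample events that involve true probabilities are handled through outer measure.
-/

namespace TradeoffTesting

/-! ### Growth of a class of finite VC dimension -/

theorem sum_choose_le_pow_add_one {m d : ℕ} (hm : 2 ≤ m) (hd : 1 ≤ d) :
    ∑ k ∈ Finset.range (d + 1), m.choose k ≤ m ^ d + 1 := by
  induction d, hd using Nat.le_induction with
  | base => simp [Finset.sum_range_succ]; omega
  | succ d hd ih =>
    rw [Finset.sum_range_succ]
    have h1 : 2 * m.choose (d + 1) ≤ m ^ (d + 1) := by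
      have h2 : m.choose (d + 1) * (d + 1).factorial ≤ m ^ (d + 1) := by
        rw [mul_comm, ← Nat.descFactorial_eq_factorial_mul_choose]
        exact Nat.descFactorial_le_pow m (d + 1)
      have h3 : 2 ≤ (d + 1).factorial := (Nat.succ_le_succ hd).trans (Nat.self_le_factorial _)
      nlinarith [Nat.zero_le (m.choose (d + 1))]
    have h4 : 2 * m ^ d ≤ m ^ (d + 1) := by
      rw [pow_succ, mul_comm]; exact Nat.mul_le_mul_left _ hm
    omega

/-- Sauer–Shelah for the traces of a class of sets on an indexed family of points. The points may
coincide, since an index set that is shattered through `x` consists of indices of distinct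
points. -/
theorem card_traces_le {X ι : Type*} [Fintype ι] [DecidableEq ι] {𝒮 : Set (Set X)} {d : ℕ}
    (hd : ∀ A, Shatters 𝒮 A → A.card ≤ d) (x : ι → X)
    [DecidablePred fun J : Finset ι => ∃ S ∈ 𝒮, ∀ i, i ∈ J ↔ x i ∈ S] :
    (Finset.univ.filter fun J : Finset ι => ∃ S ∈ 𝒮, ∀ i, i ∈ J ↔ x i ∈ S).card ≤
      ∑ k ∈ Finset.range (d + 1), (Fintype.card ι).choose k := by
  classical
  set F := Finset.univ.filter fun J : Finset ι => ∃ S ∈ 𝒮, ∀ i, i ∈ J ↔ x i ∈ S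
  have hvc : F.vcDim ≤ d := by
    refine Finset.sup_le fun s hs => ?_
    have hs : F.Shatters s := Finset.mem_shatterer.1 hs
    have hinj : Set.InjOn x s := by
      intro i hi j hj hij
      obtain ⟨u, hu, hsu⟩ := hs (t := {i}) (by simpa using hi)
      obtain ⟨S, -, hS⟩ := (Finset.mem_filter.1 hu).2
      have h1 : i ∈ s ∩ u := by rw [hsu]; simp
      have h2 : j ∈ s ∩ u :=
        Finset.mem_inter.2 ⟨hj, (hS j).2 (hij ▸ (hS i).1 (Finset.mem_inter.1 h1).2)⟩
      rw [hsu] at h2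
      exact (Finset.mem_singleton.1 h2).symm
    rw [← Finset.card_image_of_injOn hinj]
    refine hd _ fun B hB => ?_
    obtain ⟨u, hu, hsu⟩ := hs (t := s.filter fun i => x i ∈ B) (Finset.filter_subset _ _)
    obtain ⟨S, hS𝒮, hS⟩ := (Finset.mem_filter.1 hu).2
    have key : ∀ i ∈ s, (x i ∈ S ↔ x i ∈ B) := by
      intro i hi
      have := congrArg (i ∈ ·) hsu
      simpa [hi, hS i] using this
    refine ⟨S, hS𝒮, ?_⟩
    ext y
    constructor
    · rintro ⟨hy, hyS⟩
      obtain ⟨i, hi, rfl⟩ := Finset.mem_image.1 (Finset.mem_coe.1 hy)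
      exact (key i hi).1 hyS
    · intro hy
      have hy' := hB hy
      obtain ⟨i, hi, rfl⟩ := Finset.mem_image.1 (Finset.mem_coe.1 hy')
      exact ⟨hy', (key i hi).2 hy⟩
  refine (Finset.card_le_card_shatterer F).trans (Finset.card_shatterer_le_sum_vcDim.trans ?_)
  refine Finset.sum_le_sum_of_subset fun k hk => ?_
  simp only [Finset.mem_Iic, Finset.mem_range] at hk ⊢
  omega

theorem Shatters.card_le_toNat_vcDim {X : Type*} {𝒮 : Set (Set X)} (h : vcDim 𝒮 ≠ ⊤)
    {A : Finset X} (hA : Shatters 𝒮 A) : A.card ≤ (vcDim 𝒮).toNat := by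
  have h1 : (A.card : ℕ∞) ≤ vcDim 𝒮 :=
    le_iSup₂ (f := fun (A : Finset X) (_ : A ∈ {A : Finset X | Shatters 𝒮 A}) => (A.card : ℕ∞))
      A hA
  rw [← ENat.natCast_toNat h] at h1
  exact_mod_cast h1

theorem Shatters.of_compl {X : Type*} {𝒮 : Set (Set X)} {A : Finset X}
    (hA : Shatters (compl '' 𝒮) A) : Shatters 𝒮 A := by
  intro B hB
  obtain ⟨_, ⟨S, hS, rfl⟩, h⟩ := hA (A \ B) sdiff_subset
  refine ⟨S, hS, ?_⟩
  ext y
  have h1 := congrArg (y ∈ ·) h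
  have h2 := @hB y
  simp only [Set.mem_inter_iff, mem_compl_iff, mem_sdiff, eq_iff_iff] at h1 ⊢
  tauto

theorem TraceMeasurable.compl {X : Type*} [MeasurableSpace X] {𝒮 : Set (Set X)}
    (h : TraceMeasurable 𝒮) : TraceMeasurable (compl '' 𝒮) := by
  intro m I ν hν
  convert h m Iᶜ ν hν using 1
  ext x
  simp only [mem_ofPred_eq, exists_mem_image, mem_compl_iff]
  refine exists_congr fun S => and_congr_right fun _ => forall_congr' fun i => ?_
  tauto

/-! ### Random signs -/

/-- Hoeffding's inequality for a Rademacher sum, in a self-normalized form and stated by counting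
sign patterns. -/
theorem card_signs_le {n : ℕ} (c : Fin n → ℝ) {N r : ℝ} (hr : 0 ≤ r)
    (hN : ∑ i, c i ^ 2 ≤ N)
    [DecidablePred fun σ : Fin n → Bool =>
      0 < ∑ i, (if σ i then -c i else c i) ∧ r * N ≤ (∑ i, (if σ i then -c i else c i)) ^ 2] :
    ((Finset.univ.filter fun σ : Fin n → Bool =>
      0 < ∑ i, (if σ i then -c i else c i) ∧
        r * N ≤ (∑ i, (if σ i then -c i else c i)) ^ 2).card : ℝ) ≤
      2 ^ n * Real.exp (-(r / 2)) := by
  set W : (Fin n → Bool) → ℝ := fun σ => ∑ i, (if σ i then -c i else c i) with hW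
  set F := Finset.univ.filter fun σ => 0 < W σ ∧ r * N ≤ W σ ^ 2
  change (F.card : ℝ) ≤ _
  have hN0 : 0 ≤ N := (Finset.sum_nonneg fun i _ => sq_nonneg (c i)).trans hN
  rcases hN0.eq_or_lt with hN0 | hN0
  · have hc : ∀ i, c i = 0 := by
      intro i
      have h1 : ∑ i, c i ^ 2 = 0 :=
        le_antisymm (by rw [hN0]; exact hN) (Finset.sum_nonneg fun i _ => sq_nonneg (c i))
      have h2 := (Finset.sum_eq_zero_iff_of_nonneg fun i _ => sq_nonneg (c i)).1 h1 i
        (Finset.mem_univ i)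
      exact pow_eq_zero_iff two_ne_zero |>.1 h2
    have : F = ∅ := by
      refine Finset.filter_eq_empty_iff.2 fun σ _ h => ?_
      have : W σ = 0 := by simp [hW, hc]
      linarith [h.1]
    rw [this]; simp; positivity
  -- the minimizer of the Chernoff bound `l ↦ -l √(r N) + l² N / 2`
  set l : ℝ := √(r * N) / N with hl
  have hl0 : 0 ≤ l := by positivity
  have hs : √(r * N) ^ 2 = r * N := Real.sq_sqrt (by positivity)
  have hsum : ∑ σ, Real.exp (l * W σ) ≤ 2 ^ n * Real.exp (l ^ 2 * N / 2) := by
    have h1 : ∑ σ, Real.exp (l * W σ) =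
        ∏ i, ∑ b : Bool, Real.exp (l * (if b then -c i else c i)) := by
      rw [Fintype.prod_sum]
      refine Finset.sum_congr rfl fun σ _ => ?_
      rw [hW, Finset.mul_sum, Real.exp_sum]
    have h2 : ∀ i, ∑ b : Bool, Real.exp (l * (if b then -c i else c i)) ≤
        2 * Real.exp (l ^ 2 * c i ^ 2 / 2) := by
      intro i
      have := Real.cosh_le_exp_half_sq (l * c i)
      rw [Real.cosh_eq, mul_pow] at this
      simp only [Fintype.sum_bool, if_true, Bool.false_eq_true, if_false, mul_neg]
      linarith
    rw [h1]
    refine (Finset.prod_le_prod (fun i _ => Finset.sum_nonneg fun _ _ => (Real.exp_pos _).le)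
      fun i _ => h2 i).trans ?_
    rw [Finset.prod_mul_distrib, ← Real.exp_sum]
    simp only [Finset.prod_const, Finset.card_univ, Fintype.card_fin]
    gcongr
    rw [← Finset.sum_div, ← Finset.mul_sum]
    gcongr
  have hF : (F.card : ℝ) * Real.exp (l * √(r * N)) ≤ ∑ σ, Real.exp (l * W σ) := by
    rw [← nsmul_eq_mul]
    refine (Finset.card_nsmul_le_sum F (fun σ => Real.exp (l * W σ)) _ fun σ hσ => ?_).trans
      (Finset.sum_le_univ_sum_of_nonneg fun _ => (Real.exp_pos _).le)
    obtain ⟨h0, h1⟩ := (Finset.mem_filter.1 hσ).2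
    exact Real.exp_le_exp.2 (mul_le_mul_of_nonneg_left (Real.sqrt_le_iff.2 ⟨h0.le, h1⟩) hl0)
  have h3 : l * √(r * N) = r := by rw [hl]; field_simp; rw [hs]
  have h4 : l ^ 2 * N / 2 = r / 2 := by rw [hl, div_pow, hs]; field_simp
  rw [h3] at hF
  rw [h4] at hsum
  have h5 : Real.exp (-(r / 2)) = Real.exp (r / 2) / Real.exp r := by
    rw [← Real.exp_sub]; congr 1; ring
  rw [h5, ← mul_div_assoc, le_div_iff₀ (Real.exp_pos _)]
  exact hF.trans hsum

/-! ### Moments of sums of independent bounded variables -/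

section Moments

theorem abs_sum_le {X : Type*} {f : X → ℝ} (hf1 : ∀ x, |f x| ≤ 1) {n : ℕ} (x : Fin n → X) :
    |∑ i, f (x i)| ≤ n := by
  refine (Finset.abs_sum_le_sum_abs _ _).trans ?_
  simpa using Finset.sum_le_sum (s := Finset.univ) fun i _ => hf1 (x i)

variable {X : Type*} [MeasurableSpace X] {P : Measure X} [IsProbabilityMeasure P] {f : X → ℝ}

theorem measurable_sum_pi (hf : Measurable f) (n : ℕ) :
    Measurable fun x : Fin n → X => ∑ i, f (x i) :=
  Finset.measurable_sum _ fun i _ => hf.comp (measurable_pi_apply i)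

theorem integrable_sum_pow (hf : Measurable f) (hf1 : ∀ x, |f x| ≤ 1) (n k : ℕ) :
    Integrable (fun x : Fin n → X => (∑ i, f (x i)) ^ k) (Measure.pi fun _ => P) := by
  refine Integrable.of_bound ((measurable_sum_pi hf n).pow_const k).aestronglyMeasurable
    ((n : ℝ) ^ k) (Filter.Eventually.of_forall fun x => ?_)
  rw [norm_pow, Real.norm_eq_abs]
  exact pow_le_pow_left₀ (abs_nonneg _) (abs_sum_le hf1 x) k

theorem integrable_pow (hf : Measurable f) (hf1 : ∀ x, |f x| ≤ 1) (k : ℕ) :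
    Integrable (fun x => f x ^ k) P := by
  refine Integrable.of_bound (hf.pow_const k).aestronglyMeasurable 1
    (Filter.Eventually.of_forall fun x => ?_)
  rw [norm_pow, Real.norm_eq_abs]
  exact pow_le_one₀ (abs_nonneg _) (hf1 x)

theorem integral_sum_succ_pow (hf : Measurable f) (hf1 : ∀ x, |f x| ≤ 1) (n k : ℕ) :
    ∫ x : Fin (n + 1) → X, (∑ i, f (x i)) ^ k ∂(Measure.pi fun _ => P) =
      ∑ j ∈ Finset.range (k + 1), (∫ x, f x ^ j ∂P) *
        (∫ x : Fin n → X, (∑ i, f (x i)) ^ (k - j) ∂(Measure.pi fun _ => P)) * k.choose j := by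
  have hmp := measurePreserving_piFinSuccAbove (fun _ : Fin (n + 1) => P) 0
  have h1 : ∫ x : Fin (n + 1) → X, (∑ i, f (x i)) ^ k ∂(Measure.pi fun _ => P) =
      ∫ z : X × (Fin n → X), (f z.1 + ∑ i, f (z.2 i)) ^ k ∂(P.prod (Measure.pi fun _ => P)) := by
    rw [← hmp.integral_comp (MeasurableEquiv.measurableEmbedding _)]
    refine integral_congr_ae (Filter.Eventually.of_forall fun x => ?_)
    simp [Fin.sum_univ_succ, MeasurableEquiv.piFinSuccAbove, Fin.insertNthEquiv, Fin.tail]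
  rw [h1]
  simp_rw [add_pow]
  rw [integral_finsetSum]
  · refine Finset.sum_congr rfl fun j _ => ?_
    rw [integral_mul_const, integral_prod_mul (fun x => f x ^ j)
      (fun y : Fin n → X => (∑ i, f (y i)) ^ (k - j))]
  · intro j _
    exact ((integrable_pow hf hf1 j).mul_prod (integrable_sum_pow hf hf1 n (k - j))).mul_const _

theorem integral_sum_eq_zero (hf : Measurable f) (hf1 : ∀ x, |f x| ≤ 1) (h0 : ∫ x, f x ∂P = 0)
    (n : ℕ) : ∫ x : Fin n → X, ∑ i, f (x i) ∂(Measure.pi fun _ => P) = 0 := by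
  induction n with
  | zero => simp
  | succ n ih =>
    have := integral_sum_succ_pow (P := P) hf hf1 n 1
    simpa [Finset.sum_range_succ, h0, ih] using this

theorem integral_sum_sq (hf : Measurable f) (hf1 : ∀ x, |f x| ≤ 1) (h0 : ∫ x, f x ∂P = 0)
    (n : ℕ) : ∫ x : Fin n → X, (∑ i, f (x i)) ^ 2 ∂(Measure.pi fun _ => P) =
      n * ∫ x, f x ^ 2 ∂P := by
  induction n with
  | zero => simp
  | succ n ih =>
    rw [integral_sum_succ_pow hf hf1 n 2]
    simp [Finset.sum_range_succ, h0, ih]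
    ring

theorem integral_sum_pow_four_le (hf : Measurable f) (hf1 : ∀ x, |f x| ≤ 1)
    (h0 : ∫ x, f x ∂P = 0) (n : ℕ) :
    ∫ x : Fin n → X, (∑ i, f (x i)) ^ 4 ∂(Measure.pi fun _ => P) ≤
      3 * (n * ∫ x, f x ^ 2 ∂P) ^ 2 + n * ∫ x, f x ^ 2 ∂P := by
  have hv : 0 ≤ ∫ x, f x ^ 2 ∂P := integral_nonneg fun x => sq_nonneg _
  have h4 : ∫ x, f x ^ 4 ∂P ≤ ∫ x, f x ^ 2 ∂P := by
    refine integral_mono (integrable_pow hf hf1 4) (integrable_pow hf hf1 2) fun x => ?_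
    have h1 : f x ^ 2 ≤ 1 := (sq_le_one_iff_abs_le_one _).2 (hf1 x)
    have h2 : f x ^ 4 = f x ^ 2 * f x ^ 2 := by ring
    change f x ^ 4 ≤ f x ^ 2
    nlinarith [sq_nonneg (f x)]
  induction n with
  | zero => simp
  | succ n ih =>
    rw [integral_sum_succ_pow hf hf1 n 4]
    have h5 : (Nat.choose 4 2 : ℝ) = 6 := by norm_num [Nat.choose]
    simp [Finset.sum_range_succ, h0, integral_sum_eq_zero hf hf1 h0 n,
      integral_sum_sq hf hf1 h0 n, h5]
    nlinarith

end Moments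

/-! ### A lower bound for the mass above the mean -/

/-- If the indicator of `{x | t ≤ Z x}` dominates `g`, the probability of that set is at least the
mean of `g`. -/
theorem integral_le_measureReal_of_le_indicator {Ω : Type*} [MeasurableSpace Ω] {μ : Measure Ω}
    [IsProbabilityMeasure μ] {s : Set Ω} (hs : MeasurableSet s) {g : Ω → ℝ} (hg : Integrable g μ)
    (h : ∀ x, g x ≤ s.indicator (fun _ => 1) x) : ∫ x, g x ∂μ ≤ μ.real s := by
  have h1 : ∫ x, s.indicator (fun _ => (1 : ℝ)) x ∂μ = μ.real s := by
    rw [integral_indicator_const _ hs]; simp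
  rw [← h1]
  exact integral_mono hg ((integrable_const _).indicator hs) h

/-- A centred sum of independent variables bounded by `1` exceeds `-5/2` with probability at
least `1/7`. When the variance is at most `5` this is Chebyshev's inequality. When it is larger,
the sum is even non-negative with that probability: its kurtosis is at most `3 + 1 / v`, with `v`
the variance, and a quartic minorant of the indicator of `[0, ∞)` gives the bound. -/
theorem one_div_seven_le_measureReal_sum {X : Type*} [MeasurableSpace X] {P : Measure X}
    [IsProbabilityMeasure P] {f : X → ℝ} (hf : Measurable f) (hf1 : ∀ x, |f x| ≤ 1)
    (h0 : ∫ x, f x ∂P = 0) (n : ℕ) :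
    1 / 7 ≤ (Measure.pi fun _ : Fin n => P).real {x | -(5 / 2) ≤ ∑ i, f (x i)} := by
  set v : ℝ := n * ∫ x, f x ^ 2 ∂P with hv
  have hms : MeasurableSet {x : Fin n → X | -(5 / 2) ≤ ∑ i, f (x i)} :=
    measurableSet_le measurable_const (measurable_sum_pi hf n)
  have hi : ∀ k, Integrable (fun x : Fin n → X => (∑ i, f (x i)) ^ k) (Measure.pi fun _ => P) :=
    fun k => integrable_sum_pow hf hf1 n k
  have hE1 := integral_sum_eq_zero (P := P) hf hf1 h0 n
  have hE2 := integral_sum_sq (P := P) hf hf1 h0 n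
  have hE4 := integral_sum_pow_four_le (P := P) hf hf1 h0 n
  rw [← hv] at hE2 hE4
  have hi1 := hi 1
  simp only [pow_one] at hi1
  rcases le_total v 5 with h | h
  · have hg : Integrable (fun x : Fin n → X => 1 - (4 / 25) * (∑ i, f (x i)) ^ 2)
        (Measure.pi fun _ => P) := (integrable_const _).sub ((hi 2).const_mul _)
    refine le_trans ?_ (integral_le_measureReal_of_le_indicator hms hg fun x => ?_)
    · rw [integral_sub (integrable_const _) ((hi 2).const_mul _), integral_const_mul, hE2]
      simp; linarith
    · by_cases hx : x ∈ {x : Fin n → X | -(5 / 2) ≤ ∑ i, f (x i)}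
      · rw [indicator_of_mem hx]; nlinarith [sq_nonneg (∑ i, f (x i))]
      · rw [indicator_of_notMem hx]
        simp only [mem_ofPred_eq, not_le] at hx
        nlinarith
  · -- `w (w + 1)² (2 - w) ≤ 4.85` for `w ≥ 0`, and it is `≤ 0` for `w ≤ 0`; use `w = Z / √(2v)`
    have hr0 : 0 < √(2 * v) := Real.sqrt_pos.2 (by linarith)
    set r := √(2 * v) with hr
    have hr2 : r ^ 2 = 2 * v := Real.sq_sqrt (by linarith)
    have hr4 : r ^ 4 = 4 * v ^ 2 := by
      rw [show r ^ 4 = (r ^ 2) ^ 2 by ring, hr2]; ring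
    set g : (Fin n → X) → ℝ := fun x => (20 / 97) * ((2 / r) * (∑ i, f (x i)) +
      (3 / r ^ 2) * (∑ i, f (x i)) ^ 2 - (1 / r ^ 4) * (∑ i, f (x i)) ^ 4) with hgdef
    have i1 := hi1.const_mul (2 / r)
    have i2 := (hi 2).const_mul (3 / r ^ 2)
    have i12 : Integrable (fun x : Fin n → X => (2 / r) * (∑ i, f (x i)) +
      (3 / r ^ 2) * (∑ i, f (x i)) ^ 2) (Measure.pi fun _ => P) := i1.add i2
    have i4 := (hi 4).const_mul (1 / r ^ 4)
    have hg : Integrable g (Measure.pi fun _ => P) := (i12.sub i4).const_mul _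
    refine le_trans ?_ (integral_le_measureReal_of_le_indicator hms hg fun x => ?_)
    · rw [hgdef, integral_const_mul, integral_sub i12 i4, integral_add i1 i2,
        integral_const_mul, integral_const_mul, integral_const_mul, hE1, hE2, hr2, hr4]
      have h3 : 1 / (4 * v ^ 2) *
          ∫ x : Fin n → X, (∑ i, f (x i)) ^ 4 ∂(Measure.pi fun _ => P) ≤ 4 / 5 := by
        rw [one_div, inv_mul_le_iff₀ (by positivity)]
        nlinarith
      have h4 : 3 / (2 * v) * v = 3 / 2 := by field_simp
      rw [h4]
      linarith
    · have hgw : g x = (20 / 97) * (((∑ i, f (x i)) / r) * ((∑ i, f (x i)) / r + 1) ^ 2 *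
          (2 - (∑ i, f (x i)) / r)) := by
        rw [hgdef]; field_simp; ring
      rw [hgw]
      set w := (∑ i, f (x i)) / r with hw
      rcases le_or_gt 0 (∑ i, f (x i)) with hx | hx
      · rw [indicator_of_mem (by simp only [mem_ofPred_eq]; linarith)]
        have hw0 : 0 ≤ w := by positivity
        -- the maximum is attained at `w = (1 + √3) / 2`
        nlinarith [sq_nonneg (w ^ 2 - 1.366 * w - 0.5), sq_nonneg (w - 1.366),
          sq_nonneg (w ^ 2 - 1.866)]
      · have hw0 : w ≤ 0 := by rw [hw]; exact (div_neg_of_neg_of_pos hx hr0).le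
        refine le_trans ?_ (indicator_nonneg (fun _ _ => zero_le_one) x)
        have h6 : 0 ≤ (w + 1) ^ 2 * (2 - w) := mul_nonneg (sq_nonneg _) (by linarith)
        nlinarith [mul_nonneg (neg_nonneg.2 hw0) h6]

/-! ### Two independent samples of the same law -/

/-- The number of sample points `x i` that lie in `S`, as a real number. -/
noncomputable def hits {X : Type*} {n : ℕ} (S : Set X) (x : Fin n → X) : ℝ :=
  ∑ i, S.indicator (fun _ => (1 : ℝ)) (x i)

/-- The pairs of samples for which some `S ∈ 𝒮` is hit more often by the second sample than by the
first one, the square of the difference being at least `r` times the total number of hits. -/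
def gapEvent {X : Type*} (𝒮 : Set (Set X)) (n : ℕ) (r : ℝ) : Set ((Fin n → X) × (Fin n → X)) :=
  {z | ∃ S ∈ 𝒮, hits S z.1 < hits S z.2 ∧
    r * (hits S z.1 + hits S z.2) ≤ (hits S z.2 - hits S z.1) ^ 2}

/-- Exchange the `i`-th points of the two samples for all `i` with `σ i = true`. -/
def swapBy {X : Type*} {n : ℕ} (σ : Fin n → Bool) (z : (Fin n → X) × (Fin n → X)) :
    (Fin n → X) × (Fin n → X) :=
  (fun i => if σ i then z.2 i else z.1 i, fun i => if σ i then z.1 i else z.2 i)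

theorem hits_nonneg {X : Type*} {n : ℕ} (S : Set X) (x : Fin n → X) : 0 ≤ hits S x :=
  Finset.sum_nonneg fun i _ => indicator_nonneg (fun _ _ => zero_le_one) (x i)

theorem measurePreserving_swapBy {X : Type*} [MeasurableSpace X] (P : Measure X)
    [IsProbabilityMeasure P] {n : ℕ} (σ : Fin n → Bool) :
    MeasurePreserving (swapBy (X := X) σ)
      ((Measure.pi fun _ : Fin n => P).prod (Measure.pi fun _ : Fin n => P))
      ((Measure.pi fun _ : Fin n => P).prod (Measure.pi fun _ : Fin n => P)) := by
  have he := measurePreserving_arrowProdEquivProdArrow X X (Fin n) (fun _ => P) (fun _ => P)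
  have hs : MeasurePreserving (fun (w : Fin n → X × X) i => (if σ i then Prod.swap else id) (w i))
      (Measure.pi fun _ => P.prod P) (Measure.pi fun _ => P.prod P) := by
    refine measurePreserving_pi _ _ (f := fun i => if σ i then Prod.swap else id) fun i => ?_
    cases σ i
    · exact MeasurePreserving.id _
    · exact Measure.measurePreserving_swap
  convert he.comp (hs.comp (he.symm _)) using 1
  ext z i <;> by_cases h : σ i <;> simp [swapBy, h, MeasurableEquiv.arrowProdEquivProdArrow,
    Equiv.arrowProdEquivProdArrow]

/-- The condition in `gapEvent` for a set that hits, among the `2n` points of the joined samples,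
exactly those with index in `J`. -/
def GapPattern (n : ℕ) (r : ℝ) (J : Finset (Fin (n + n))) : Prop :=
  ∑ i, (if Fin.castAdd n i ∈ J then (1 : ℝ) else 0) <
      ∑ i, (if Fin.natAdd n i ∈ J then (1 : ℝ) else 0) ∧
    r * (∑ i, (if Fin.castAdd n i ∈ J then (1 : ℝ) else 0) +
        ∑ i, (if Fin.natAdd n i ∈ J then (1 : ℝ) else 0)) ≤
      (∑ i, (if Fin.natAdd n i ∈ J then (1 : ℝ) else 0) -
        ∑ i, (if Fin.castAdd n i ∈ J then (1 : ℝ) else 0)) ^ 2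

theorem gapEvent_eq_iUnion {X : Type*} (𝒮 : Set (Set X)) (n : ℕ) (r : ℝ) :
    gapEvent 𝒮 n r = ⋃ (J : Finset (Fin (n + n))) (_ : GapPattern n r J),
      {z | ∃ S ∈ 𝒮, ∀ i, Fin.append z.1 z.2 i ∈ S ↔ i ∈ (J : Set (Fin (n + n)))} := by
  classical
  have key : ∀ (S : Set X) (J : Finset (Fin (n + n))) (z : (Fin n → X) × (Fin n → X)),
      (∀ i, Fin.append z.1 z.2 i ∈ S ↔ i ∈ (J : Set (Fin (n + n)))) →
      hits S z.1 = ∑ i, (if Fin.castAdd n i ∈ J then (1 : ℝ) else 0) ∧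
      hits S z.2 = ∑ i, (if Fin.natAdd n i ∈ J then (1 : ℝ) else 0) := by
    intro S J z h
    constructor
    · refine Finset.sum_congr rfl fun i _ => ?_
      have := h (Fin.castAdd n i)
      simp only [Fin.append_left, Finset.mem_coe] at this
      simp [indicator_apply, this]
    · refine Finset.sum_congr rfl fun i _ => ?_
      have := h (Fin.natAdd n i)
      simp only [Fin.append_right, Finset.mem_coe] at this
      simp [indicator_apply, this]
  ext z
  simp only [mem_iUnion, gapEvent, mem_ofPred_eq]
  constructor
  · rintro ⟨S, hS, h1, h2⟩
    have hJ : ∀ i, Fin.append z.1 z.2 i ∈ S ↔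
        i ∈ ((Finset.univ.filter fun i => Fin.append z.1 z.2 i ∈ S : Finset (Fin (n + n))) :
          Set (Fin (n + n))) := by simp
    obtain ⟨e1, e2⟩ := key S _ z hJ
    refine ⟨_, ?_, S, hS, hJ⟩
    unfold GapPattern
    rw [← e1, ← e2]
    exact ⟨h1, h2⟩
  · rintro ⟨J, hJ, S, hS, h⟩
    obtain ⟨e1, e2⟩ := key S J z h
    unfold GapPattern at hJ
    rw [← e1, ← e2] at hJ
    exact ⟨S, hS, hJ⟩

theorem nullMeasurableSet_gapEvent {X : Type*} [MeasurableSpace X] {𝒮 : Set (Set X)}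
    (htr : TraceMeasurable 𝒮) (n : ℕ) (r : ℝ) (μ : Measure ((Fin n → X) × (Fin n → X)))
    [IsProbabilityMeasure μ] : NullMeasurableSet (gapEvent 𝒮 n r) μ := by
  rw [gapEvent_eq_iUnion]
  refine NullMeasurableSet.iUnion fun J => NullMeasurableSet.iUnion fun _ => ?_
  have hm : Measurable fun z : (Fin n → X) × (Fin n → X) => Fin.append z.1 z.2 := by
    refine measurable_pi_lambda _ fun i => ?_
    refine Fin.addCases (fun i => ?_) (fun i => ?_) i
    · simp only [Fin.append_left]; fun_prop
    · simp only [Fin.append_right]; fun_prop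
  have hmp : MeasurePreserving (fun z : (Fin n → X) × (Fin n → X) => Fin.append z.1 z.2) μ
      (μ.map fun z => Fin.append z.1 z.2) := hm.measurePreserving μ
  exact (htr (n + n) J _ (Measure.isProbabilityMeasure_map hm.aemeasurable)).preimage
    hmp.quasiMeasurePreserving

theorem card_swapBy_mem_gapEvent_le {X : Type*} {𝒮 : Set (Set X)} {d : ℕ}
    (hd : ∀ A, Shatters 𝒮 A → A.card ≤ d) {n : ℕ} {r : ℝ} (hr : 0 ≤ r)
    (z : (Fin n → X) × (Fin n → X)) [DecidablePred fun σ => swapBy σ z ∈ gapEvent 𝒮 n r] :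
    ((Finset.univ.filter fun σ => swapBy σ z ∈ gapEvent 𝒮 n r).card : ℝ) ≤
      (∑ k ∈ Finset.range (d + 1), (n + n).choose k : ℕ) * (2 ^ n * Real.exp (-(r / 2))) := by
  classical
  set F := Finset.univ.filter fun J : Finset (Fin (n + n)) =>
    ∃ S ∈ 𝒮, ∀ i, i ∈ J ↔ Fin.append z.1 z.2 i ∈ S
  -- the hits of the two samples, point by point, for a set with trace `J`
  set a : Finset (Fin (n + n)) → Fin n → ℝ := fun J i => if Fin.castAdd n i ∈ J then 1 else 0
    with ha
  set b : Finset (Fin (n + n)) → Fin n → ℝ := fun J i => if Fin.natAdd n i ∈ J then 1 else 0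
    with hb
  set E : Finset (Fin (n + n)) → Finset (Fin n → Bool) := fun J => Finset.univ.filter fun σ =>
    0 < ∑ i, (if σ i then -(b J i - a J i) else (b J i - a J i)) ∧
      r * (∑ i, (a J i + b J i)) ≤
        (∑ i, (if σ i then -(b J i - a J i) else (b J i - a J i))) ^ 2
  have hsub : (Finset.univ.filter fun σ => swapBy σ z ∈ gapEvent 𝒮 n r) ⊆ F.biUnion E := by
    intro σ hσ
    obtain ⟨S, hS, h1, h2⟩ := (Finset.mem_filter.1 hσ).2
    set J := Finset.univ.filter fun i => Fin.append z.1 z.2 i ∈ S with hJ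
    have e1 : hits S (swapBy σ z).2 - hits S (swapBy σ z).1 =
        ∑ i, (if σ i then -(b J i - a J i) else (b J i - a J i)) := by
      rw [hits, hits, ← Finset.sum_sub_distrib]
      refine Finset.sum_congr rfl fun i _ => ?_
      by_cases h : σ i <;> simp [swapBy, h, hJ, ha, hb, indicator_apply, -Fin.natAdd_eq_addNat]
    have e2 : hits S (swapBy σ z).1 + hits S (swapBy σ z).2 = ∑ i, (a J i + b J i) := by
      rw [hits, hits, ← Finset.sum_add_distrib]
      refine Finset.sum_congr rfl fun i _ => ?_
      by_cases h : σ i <;> simp [swapBy, h, hJ, ha, hb, indicator_apply, add_comm,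
        -Fin.natAdd_eq_addNat]
    refine Finset.mem_biUnion.2 ⟨J, ?_, ?_⟩
    · exact Finset.mem_filter.2 ⟨Finset.mem_univ _, S, hS, fun i => by simp [hJ]⟩
    · refine Finset.mem_filter.2 ⟨Finset.mem_univ _, ?_⟩
      rw [← e1, ← e2]
      exact ⟨sub_pos.2 h1, h2⟩
  have hEJ : ∀ J, ((E J).card : ℝ) ≤ 2 ^ n * Real.exp (-(r / 2)) := by
    intro J
    refine card_signs_le (fun i => b J i - a J i) hr (Finset.sum_le_sum fun i _ => ?_)
    simp only [ha, hb]
    split_ifs <;> norm_num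
  have hFc : F.card ≤ ∑ k ∈ Finset.range (d + 1), (n + n).choose k := by
    simpa using card_traces_le hd (Fin.append z.1 z.2)
  calc ((Finset.univ.filter fun σ => swapBy σ z ∈ gapEvent 𝒮 n r).card : ℝ)
      ≤ ((∑ J ∈ F, (E J).card : ℕ) : ℝ) := by
        exact_mod_cast (Finset.card_le_card hsub).trans Finset.card_biUnion_le
    _ ≤ ∑ J ∈ F, 2 ^ n * Real.exp (-(r / 2)) := by
        push_cast; exact Finset.sum_le_sum fun J _ => hEJ J
    _ = F.card * (2 ^ n * Real.exp (-(r / 2))) := by simp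
    _ ≤ _ := by gcongr

/-- The law of the two samples is invariant under all exchanges, so the probability of `gapEvent`
is at most the largest proportion of exchanges that lead a fixed pair of samples into it. -/
theorem measure_gapEvent_le {X : Type*} [MeasurableSpace X] {𝒮 : Set (Set X)}
    (htr : TraceMeasurable 𝒮) {d : ℕ} (hd : ∀ A, Shatters 𝒮 A → A.card ≤ d) (n : ℕ) {r : ℝ}
    (hr : 0 ≤ r) (P : Measure X) [IsProbabilityMeasure P] :
    ((Measure.pi fun _ : Fin n => P).prod (Measure.pi fun _ : Fin n => P)) (gapEvent 𝒮 n r) ≤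
      ENNReal.ofReal ((∑ k ∈ Finset.range (d + 1), (n + n).choose k : ℕ) *
        Real.exp (-(r / 2))) := by
  classical
  set μ := (Measure.pi fun _ : Fin n => P).prod (Measure.pi fun _ : Fin n => P)
  set B := gapEvent 𝒮 n r
  set G : ℝ := ((∑ k ∈ Finset.range (d + 1), (n + n).choose k : ℕ) : ℝ)
  have hB : NullMeasurableSet B μ := nullMeasurableSet_gapEvent htr n r μ
  have hσ : ∀ σ : Fin n → Bool, NullMeasurableSet (swapBy σ ⁻¹' B) μ := fun σ =>
    hB.preimage (measurePreserving_swapBy P σ).quasiMeasurePreserving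
  have h1 : (2 : ℝ≥0∞) ^ n * μ B ≤ 2 ^ n * ENNReal.ofReal (G * Real.exp (-(r / 2))) :=
    calc (2 : ℝ≥0∞) ^ n * μ B = ∑ σ : Fin n → Bool, μ (swapBy σ ⁻¹' B) := by
          simp [(measurePreserving_swapBy P _).measure_preimage hB, μ]
      _ = ∑ σ : Fin n → Bool, ∫⁻ z, (swapBy σ ⁻¹' B).indicator 1 z ∂μ := by
          simp_rw [lintegral_indicator_one₀ (hσ _)]
      _ = ∫⁻ z, ∑ σ : Fin n → Bool, (swapBy σ ⁻¹' B).indicator 1 z ∂μ := by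
          exact (lintegral_finsetSum' _ fun σ _ =>
            (aemeasurable_indicator_const_iff (1 : ℝ≥0∞)).2 (hσ σ)).symm
      _ ≤ ∫⁻ _, ENNReal.ofReal (G * (2 ^ n * Real.exp (-(r / 2)))) ∂μ := by
          refine lintegral_mono fun z => ?_
          have : ∑ σ : Fin n → Bool, (swapBy σ ⁻¹' B).indicator 1 z =
              ((Finset.univ.filter fun σ => swapBy σ z ∈ B).card : ℝ≥0∞) := by
            simp [indicator_apply, Finset.sum_boole]
          refine this.trans_le ?_
          rw [← ENNReal.ofReal_natCast]
          exact ENNReal.ofReal_le_ofReal (card_swapBy_mem_gapEvent_le hd hr z)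
      _ = 2 ^ n * ENNReal.ofReal (G * Real.exp (-(r / 2))) := by
          rw [lintegral_const, measure_univ, mul_one,
            show G * (2 ^ n * Real.exp (-(r / 2))) = 2 ^ n * (G * Real.exp (-(r / 2))) by ring,
            ENNReal.ofReal_mul (by positivity), ENNReal.ofReal_pow (by norm_num)]
          simp
  exact (ENNReal.mul_le_mul_iff_right (by simp) (by simp)).1 h1

/-! ### Symmetrization -/

/-- Passage from a sample to a pair of samples. No measurability of `A` or `B` is needed, `μ A`
being an outer measure. -/
theorem measure_le_mul_measure_prod {Ω : Type*} [MeasurableSpace Ω] {μ : Measure Ω} [SFinite μ]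
    {A : Set Ω} {B : Set (Ω × Ω)} {c : ℝ≥0∞} (h : ∀ x ∈ A, c ≤ μ {y | (x, y) ∈ B}) :
    c * μ A ≤ μ.prod μ B := by
  set B' := toMeasurable (μ.prod μ) B
  have hB' : MeasurableSet B' := measurableSet_toMeasurable _ _
  have hA : A ⊆ {x | c ≤ μ (Prod.mk x ⁻¹' B')} := fun x hx =>
    (h x hx).trans (measure_mono fun y hy => subset_toMeasurable _ _ hy)
  calc c * μ A ≤ c * μ {x | c ≤ μ (Prod.mk x ⁻¹' B')} := by gcongr
    _ ≤ ∫⁻ x, μ (Prod.mk x ⁻¹' B') ∂μ :=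
        mul_meas_ge_le_lintegral₀ (measurable_measure_prodMk_left hB').aemeasurable _
    _ = μ.prod μ B' := (Measure.prod_apply hB').symm
    _ = μ.prod μ B := measure_toMeasurable B

section Ghost

variable {X : Type*} [MeasurableSpace X] (P : Measure X) [IsProbabilityMeasure P] {S : Set X}

theorem inv_seven_le_measure_hits_ge (hS : MeasurableSet S) (n : ℕ) :
    7⁻¹ ≤ (Measure.pi fun _ : Fin n => P) {y | n * P.real S - 5 / 2 ≤ hits S y} := by
  have hp0 : 0 ≤ P.real S := measureReal_nonneg
  have hp1 : P.real S ≤ 1 := measureReal_le_one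
  have hi : Integrable (S.indicator fun _ => (1 : ℝ)) P := (integrable_const _).indicator hS
  have := one_div_seven_le_measureReal_sum (P := P)
    (f := fun x => S.indicator (fun _ => (1 : ℝ)) x - P.real S)
    ((measurable_const.indicator hS).sub_const _)
    (fun x => by
      by_cases hx : x ∈ S <;> simp only [hx, indicator_of_mem, indicator_of_notMem,
        not_false_eq_true] <;> rw [abs_le] <;> constructor <;> linarith)
    (by rw [integral_sub hi (integrable_const _), integral_indicator_const _ hS]; simp) n
  have h7 := ENNReal.ofReal_le_ofReal this
  rw [ofReal_measureReal, one_div, ENNReal.ofReal_inv_of_pos (by norm_num),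
    ENNReal.ofReal_ofNat] at h7
  refine h7.trans_eq ?_
  congr 1
  ext y
  simp only [mem_ofPred_eq, Finset.sum_sub_distrib, hits]
  simp only [Finset.sum_const, Finset.card_univ, Fintype.card_fin, nsmul_eq_mul]
  constructor <;> intro h <;> linarith

theorem inv_seven_le_measure_hits_le (hS : MeasurableSet S) (n : ℕ) :
    7⁻¹ ≤ (Measure.pi fun _ : Fin n => P) {y | hits S y ≤ n * P.real S + 5 / 2} := by
  have h := inv_seven_le_measure_hits_ge P hS.compl n
  have hits_compl : ∀ y : Fin n → X, hits Sᶜ y = n - hits S y := by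
    intro y
    rw [eq_sub_iff_add_eq, hits, hits, ← Finset.sum_add_distrib]
    simp [indicator_compl]
  refine h.trans_eq ?_
  congr 1
  ext y
  rw [mem_ofPred_eq, mem_ofPred_eq, hits_compl, probReal_compl_eq_one_sub hS]
  constructor <;> intro h <;> linarith

end Ghost

theorem empProb_eq_hits_div {X : Type*} {n : ℕ} (x : Fin n → X) (S : Set X) :
    empProb x S = hits S x / n := rfl

theorem empProb_mem_Icc {X : Type*} {n : ℕ} (x : Fin n → X) (S : Set X) :
    empProb x S ∈ Icc (0 : ℝ) 1 := by
  refine ⟨div_nonneg (hits_nonneg S x) n.cast_nonneg, div_le_one_of_le₀ ?_ n.cast_nonneg⟩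
  simpa using Finset.sum_le_sum (s := Finset.univ) fun i _ =>
    indicator_le_self' (s := S) (f := fun _ => (1 : ℝ)) (fun _ _ => zero_le_one) (x i)

/-! ### Uniform relative deviations -/

theorem nat_mul_tau {d n : ℕ} (hn : 1 ≤ n) (δ : ℝ) :
    n * tau d n δ = 4 * (d * Real.log (2 * n) + Real.log (32 / δ)) := by
  have : (n : ℝ) ≠ 0 := by positivity
  rw [tau]; field_simp

theorem le_nat_mul_tau {d n : ℕ} (hn : 1 ≤ n) {δ : ℝ} (hδ : δ ∈ Ioo (0 : ℝ) 1) :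
    25 / 2 ≤ n * tau d n δ := by
  rw [nat_mul_tau hn]
  have hn' : (1 : ℝ) ≤ n := by exact_mod_cast hn
  have h1 : 0 ≤ d * Real.log (2 * n) :=
    mul_nonneg d.cast_nonneg (Real.log_nonneg (by linarith))
  have h2 : Real.log 32 ≤ Real.log (32 / δ) := by
    refine Real.log_le_log (by norm_num) ?_
    rw [le_div_iff₀ hδ.1]; linarith [hδ.2]
  have h3 : Real.log 32 = 5 * Real.log 2 := by
    rw [show (32 : ℝ) = 2 ^ 5 by norm_num, Real.log_pow]; norm_num
  linarith [Real.log_two_gt_d9]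

theorem tau_pos {d n : ℕ} (hn : 1 ≤ n) {δ : ℝ} (hδ : δ ∈ Ioo (0 : ℝ) 1) : 0 < tau d n δ := by
  have h := le_nat_mul_tau (d := d) hn hδ
  have hn' : (0 : ℝ) < n := by exact_mod_cast hn
  by_contra hc
  nlinarith [not_lt.1 hc]

/-- The choice of `τ` makes the union bound work: the factor `7` is the price of symmetrization. -/
theorem seven_mul_growth_mul_exp_le {d n : ℕ} (hn : 1 ≤ n) {δ : ℝ} (hδ : δ ∈ Ioo (0 : ℝ) 1)
    (hτ : tau d n δ < 1) :
    7 * ((∑ k ∈ Finset.range (d + 1), (n + n).choose k : ℕ) *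
      Real.exp (-(n * tau d n δ / 2 / 2))) ≤ δ / 4 := by
  have hn' : (0 : ℝ) < n := by exact_mod_cast hn
  have hn12 : 12 < n := by
    have h := le_nat_mul_tau (d := d) hn hδ
    have : (12 : ℝ) < n := by nlinarith
    exact_mod_cast this
  have hexp : Real.exp (-(n * tau d n δ / 2 / 2)) = δ / 32 / (2 * n) ^ d := by
    have hδ0 := hδ.1
    rw [nat_mul_tau hn, show -(4 * (d * Real.log (2 * n) + Real.log (32 / δ)) / 2 / 2) =
      -(d * Real.log (2 * n)) + -Real.log (32 / δ) by ring, Real.exp_add, Real.exp_neg,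
      Real.exp_neg, Real.exp_log (by positivity), ← Real.log_pow, Real.exp_log (by positivity)]
    field_simp
  have hG : 7 * ∑ k ∈ Finset.range (d + 1), (n + n).choose k ≤ 8 * (2 * n) ^ d := by
    rcases Nat.eq_zero_or_pos d with rfl | hd
    · simp
    · have h1 := sum_choose_le_pow_add_one (m := n + n) (d := d) (by omega) hd
      have h2 : 7 ≤ (2 * n) ^ d := le_trans (by omega) (Nat.le_self_pow hd.ne' (2 * n))
      rw [← two_mul] at h1 ⊢
      omega
  have hG' : 7 * ((∑ k ∈ Finset.range (d + 1), (n + n).choose k : ℕ) : ℝ) ≤ 8 * (2 * n) ^ d := by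
    exact_mod_cast hG
  rw [hexp, ← mul_assoc]
  calc _ ≤ 8 * (2 * (n : ℝ)) ^ d * (δ / 32 / (2 * n) ^ d) := by
        have := hδ.1; gcongr
    _ = δ / 4 := by field_simp; ring

/-- The ghost sample's count may miss its mean by a fifth of `t = n τ` in the unfavourable
direction: here `lo` and `lo + u` are the smaller and the larger one of the two counts. -/
theorem gap_of_deviation {t lo u s : ℝ} (ht : 0 ≤ t) (hs : 0 ≤ s) (hu : 4 / 5 * t + s ≤ u)
    (hlo : t * lo ≤ s ^ 2 + t ^ 2 / 5) : t / 2 * (lo + (lo + u)) ≤ u ^ 2 := by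
  have h1 : (4 / 5 * t + s) * (3 / 10 * t + s) ≤ u * (u - t / 2) :=
    mul_le_mul hu (by linarith) (by positivity) (by linarith)
  nlinarith [mul_nonneg ht hs]

section Deviation

variable {X : Type*} [MeasurableSpace X] {𝒮 : Set (Set X)} {d n : ℕ} {δ : ℝ}

/-- The bound for a one-sample event each of whose points is completed to a point of `gapEvent`, up
to a reordering of the samples, by an independent sample with probability at least `1/7`. -/
theorem measure_le_of_ghost (htr : TraceMeasurable 𝒮) (hd : ∀ A, Shatters 𝒮 A → A.card ≤ d)
    (hn : 1 ≤ n) (hδ : δ ∈ Ioo (0 : ℝ) 1) (P : Measure X) [IsProbabilityMeasure P]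
    (hτ : tau d n δ < 1) {A : Set (Fin n → X)} {B : Set ((Fin n → X) × (Fin n → X))}
    (hA : ∀ x ∈ A, 7⁻¹ ≤ (Measure.pi fun _ => P) {y | (x, y) ∈ B})
    (hB : ((Measure.pi fun _ => P).prod (Measure.pi fun _ => P)) B =
      ((Measure.pi fun _ => P).prod (Measure.pi fun _ => P))
        (gapEvent 𝒮 n (n * tau d n δ / 2))) :
    (Measure.pi fun _ => P) A ≤ ENNReal.ofReal (δ / 4) := by
  have h := measure_le_mul_measure_prod hA
  have hτ0 : 0 < tau d n δ := tau_pos hn hδ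
  rw [ENNReal.inv_mul_le_iff (by norm_num) (by norm_num), hB] at h
  refine h.trans ?_
  calc _ ≤ 7 * ENNReal.ofReal ((∑ k ∈ Finset.range (d + 1), (n + n).choose k : ℕ) *
        Real.exp (-(n * tau d n δ / 2 / 2))) := by
        gcongr; exact measure_gapEvent_le htr hd n (by positivity) P
    _ = ENNReal.ofReal (7 * ((∑ k ∈ Finset.range (d + 1), (n + n).choose k : ℕ) *
        Real.exp (-(n * tau d n δ / 2 / 2)))) := by
        rw [ENNReal.ofReal_mul (by norm_num : (0 : ℝ) ≤ 7), ENNReal.ofReal_ofNat]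
    _ ≤ _ := ENNReal.ofReal_le_ofReal (seven_mul_growth_mul_exp_le hn hδ hτ)

/-- Uniformly over the class, true probabilities exceed empirical ones by little. -/
theorem measure_exists_empProb_add_lt_le (h𝒮 : ∀ S ∈ 𝒮, MeasurableSet S)
    (htr : TraceMeasurable 𝒮) (hd : ∀ A, Shatters 𝒮 A → A.card ≤ d) (hn : 1 ≤ n)
    (hδ : δ ∈ Ioo (0 : ℝ) 1) (P : Measure X) [IsProbabilityMeasure P] :
    (Measure.pi fun _ : Fin n => P) {x | ∃ S ∈ 𝒮,
      empProb x S + √(tau d n δ * empProb x S) + tau d n δ < P.real S} ≤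
      ENNReal.ofReal (δ / 4) := by
  set τ := tau d n δ with hτdef
  set μ := Measure.pi fun _ : Fin n => P
  have hτ0 : 0 < τ := tau_pos hn hδ
  have hn' : (0 : ℝ) < n := by exact_mod_cast hn
  rcases le_or_gt 1 τ with hτ | hτ
  · refine (measure_mono_null (fun x hx => ?_) measure_empty).trans_le zero_le
    obtain ⟨S, -, hS⟩ := hx
    have h1 : P.real S ≤ 1 := measureReal_le_one
    have h2 := (empProb_mem_Icc x S).1
    have h3 := Real.sqrt_nonneg (τ * empProb x S)
    exact absurd hS (not_lt.2 (by linarith))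
  have ht := le_nat_mul_tau (d := d) hn hδ
  rw [← hτdef] at ht
  have hghost : ∀ x ∈ {x : Fin n → X | ∃ S ∈ 𝒮,
      empProb x S + √(τ * empProb x S) + τ < P.real S},
      (7 : ℝ≥0∞)⁻¹ ≤ μ {y | (x, y) ∈ gapEvent 𝒮 n (n * τ / 2)} := by
    rintro x ⟨S, hS, hx⟩
    refine (inv_seven_le_measure_hits_ge P (h𝒮 S hS) n).trans (measure_mono fun y hy => ?_)
    simp only [mem_ofPred_eq] at hy
    have hs : √(n * τ * hits S x) = n * √(τ * empProb x S) := by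
      rw [empProb_eq_hits_div, show n * τ * hits S x = n ^ 2 * (τ * (hits S x / n)) by
        field_simp, Real.sqrt_mul (by positivity), Real.sqrt_sq hn'.le]
    have hx' : hits S x + n * √(τ * empProb x S) + n * τ < n * P.real S := by
      have := mul_lt_mul_of_pos_left hx hn'
      rwa [mul_add, mul_add, empProb_eq_hits_div, mul_div_cancel₀ _ hn'.ne',
        ← empProb_eq_hits_div] at this
    rw [← hs] at hx'
    have h0 := hits_nonneg S x
    have h3 := Real.sqrt_nonneg (n * τ * hits S x)
    have hgap := gap_of_deviation (t := n * τ) (lo := hits S x) (u := hits S y - hits S x)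
      (s := √(n * τ * hits S x)) (by positivity) h3 (by linarith)
      (by rw [Real.sq_sqrt (by positivity)]; nlinarith)
    refine ⟨S, hS, by simp only; linarith, ?_⟩
    simpa using hgap
  exact measure_le_of_ghost htr hd hn hδ P hτ hghost rfl

/-- Uniformly over the class, empirical probabilities exceed true ones by little. -/
theorem measure_exists_add_lt_empProb_le (h𝒮 : ∀ S ∈ 𝒮, MeasurableSet S)
    (htr : TraceMeasurable 𝒮) (hd : ∀ A, Shatters 𝒮 A → A.card ≤ d) (hn : 1 ≤ n)
    (hδ : δ ∈ Ioo (0 : ℝ) 1) (P : Measure X) [IsProbabilityMeasure P] :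
    (Measure.pi fun _ : Fin n => P) {x | ∃ S ∈ 𝒮,
      P.real S + √(tau d n δ * P.real S) + tau d n δ < empProb x S} ≤
      ENNReal.ofReal (δ / 4) := by
  set τ := tau d n δ with hτdef
  set μ := Measure.pi fun _ : Fin n => P
  have hτ0 : 0 < τ := tau_pos hn hδ
  have hn' : (0 : ℝ) < n := by exact_mod_cast hn
  rcases le_or_gt 1 τ with hτ | hτ
  · refine (measure_mono_null (fun x hx => ?_) measure_empty).trans_le zero_le
    obtain ⟨S, -, hS⟩ := hx
    have h1 : 0 ≤ P.real S := measureReal_nonneg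
    have h2 := (empProb_mem_Icc x S).2
    have h3 := Real.sqrt_nonneg (τ * P.real S)
    exact absurd hS (not_lt.2 (by linarith))
  have ht := le_nat_mul_tau (d := d) hn hδ
  rw [← hτdef] at ht
  have hghost : ∀ x ∈ {x : Fin n → X | ∃ S ∈ 𝒮, P.real S + √(τ * P.real S) + τ < empProb x S},
      (7 : ℝ≥0∞)⁻¹ ≤ μ {y | (x, y) ∈ Prod.swap ⁻¹' gapEvent 𝒮 n (n * τ / 2)} := by
    rintro x ⟨S, hS, hx⟩
    refine (inv_seven_le_measure_hits_le P (h𝒮 S hS) n).trans (measure_mono fun y hy => ?_)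
    simp only [mem_ofPred_eq] at hy
    have hp0 : 0 ≤ P.real S := measureReal_nonneg
    have hs : √(n * τ * (n * P.real S)) = n * √(τ * P.real S) := by
      rw [show n * τ * (n * P.real S) = n ^ 2 * (τ * P.real S) by ring,
        Real.sqrt_mul (by positivity), Real.sqrt_sq hn'.le]
    have hx' : n * P.real S + n * √(τ * P.real S) + n * τ < hits S x := by
      have := mul_lt_mul_of_pos_left hx hn'
      rwa [mul_add, mul_add, empProb_eq_hits_div, mul_div_cancel₀ _ hn'.ne'] at this
    rw [← hs] at hx'
    have h3 := Real.sqrt_nonneg (n * τ * (n * P.real S))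
    have hgap := gap_of_deviation (t := n * τ) (lo := hits S y) (u := hits S x - hits S y)
      (s := √(n * τ * (n * P.real S))) (by positivity) h3 (by linarith)
      (by rw [Real.sq_sqrt (by positivity)]; nlinarith)
    refine ⟨S, hS, by simp only [Prod.fst_swap, Prod.snd_swap]; linarith, ?_⟩
    simpa using hgap
  exact measure_le_of_ghost htr hd hn hδ P hτ hghost
    (Measure.measurePreserving_swap.measure_preimage (nullMeasurableSet_gapEvent htr n _ _))

end Deviation

/-! ### The upper confidence map -/

section Confidence

variable {τ s t p : ℝ}

theorem hUp_le_one : hUp τ t ≤ 1 := min_le_right _ _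

theorem V_of_le_one (ht : t ≤ 1) : V t = min t (1 - t) := by
  rw [V, max_eq_left (by linarith)]

theorem hUp_mem_Icc (hτ : 0 ≤ τ) (ht : 0 ≤ t) : hUp τ t ∈ Icc (0 : ℝ) 1 :=
  ⟨le_min (by positivity) zero_le_one, hUp_le_one⟩

/-- Where `1 - t ≤ τ` the map is constant with value `1`; below that, the slope of
`t ↦ √(τ (1 - t))` is at least `-1/2`. -/
theorem hUp_monotoneOn (hτ : 0 < τ) : MonotoneOn (hUp τ) (Icc 0 1) := by
  intro s hs t ht hst
  rcases le_or_gt (1 - t) τ with h | h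
  · have : hUp τ t = 1 := by
      rw [hUp, min_eq_right]
      linarith [Real.sqrt_nonneg (τ * V t)]
    rw [this]; exact hUp_le_one
  · refine min_le_min_right _ (add_le_add_left ?_ _)
    rw [V_of_le_one hs.2, V_of_le_one ht.2]
    rcases le_total t (1 - t) with h1 | h1
    · rw [min_eq_left h1, min_eq_left (by linarith)]
      gcongr
    · rw [min_eq_right h1]
      have h2 : √(τ * min s (1 - s)) ≤ √(τ * (1 - s)) := by
        gcongr; exact min_le_right _ _
      have h3 : √(τ * (1 - s)) ≤ (t - s) + √(τ * (1 - t)) := by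
        have h4 : τ ≤ √(τ * (1 - t)) := Real.le_sqrt_of_sq_le (by nlinarith)
        have h5 : √(τ * (1 - t)) ^ 2 = τ * (1 - t) := Real.sq_sqrt (by nlinarith)
        refine Real.sqrt_le_iff.2 ⟨by linarith, ?_⟩
        nlinarith [sq_nonneg (t - s)]
      linarith

theorem hUp_lt_of_lt_hInv (hs : s ∈ Icc (0 : ℝ) 1) (h : s < hInv τ t) : hUp τ s < t := by
  by_contra hc
  exact absurd h (not_lt.2 (csInf_le ⟨0, fun _ hx => hx.1.1⟩ ⟨hs, not_lt.1 hc⟩))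

theorem lt_of_hUp_lt (ht : t ≤ 1) (hp : p ≤ 1) (h : hUp τ t < p) :
    t + √(τ * t) + τ < p ∨ t + √(τ * (1 - t)) + τ < p := by
  rw [hUp, V_of_le_one ht] at h
  rcases min_lt_iff.1 h with h | h
  · rcases min_choice t (1 - t) with e | e <;> rw [e] at h
    · exact .inl h
    · exact .inr h
  · exact absurd h (not_lt.2 hp)

end Confidence

theorem empProb_compl {X : Type*} {n : ℕ} (hn : 1 ≤ n) (x : Fin n → X) (S : Set X) :
    empProb x Sᶜ = 1 - empProb x S := by
  have hn' : (n : ℝ) ≠ 0 := by positivity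
  rw [eq_sub_iff_add_eq, empProb, empProb, ← add_div, ← Finset.sum_add_distrib]
  simp [indicator_compl, hn']

section Bands

variable {X : Type*} [MeasurableSpace X] {𝒮 : Set (Set X)} {d n : ℕ} {δ : ℝ}

theorem measurableSet_of_mem_image_compl (h𝒮 : ∀ S ∈ 𝒮, MeasurableSet S) :
    ∀ S ∈ compl '' 𝒮, MeasurableSet S := by
  rintro _ ⟨S, hS, rfl⟩
  exact (h𝒮 S hS).compl

theorem measure_union_le_ofReal_half {Ω : Type*} [MeasurableSpace Ω] {μ : Measure Ω}
    {A B C : Set Ω} (hδ : 0 < δ) (hA : μ A ≤ ENNReal.ofReal (δ / 4))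
    (hB : μ B ≤ ENNReal.ofReal (δ / 4)) (hC : C ⊆ A ∪ B) : μ C ≤ ENNReal.ofReal (δ / 2) := by
  refine (measure_mono hC).trans ((measure_union_le _ _).trans ((add_le_add hA hB).trans ?_))
  rw [← ENNReal.ofReal_add (by linarith) (by linarith)]
  exact ENNReal.ofReal_le_ofReal (by linarith)

/-- `h₊` of the empirical probabilities is a uniform upper confidence band. Where the term `1 - t`
in `V t` is the smaller one, the deviation is that of the complement, in the other direction. -/
theorem measure_exists_hUp_empProb_lt_le (h𝒮 : ∀ S ∈ 𝒮, MeasurableSet S)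
    (htr : TraceMeasurable 𝒮) (hd : ∀ A, Shatters 𝒮 A → A.card ≤ d) (hn : 1 ≤ n)
    (hδ : δ ∈ Ioo (0 : ℝ) 1) (P : Measure X) [IsProbabilityMeasure P] :
    (Measure.pi fun _ : Fin n => P) {x | ∃ S ∈ 𝒮, hUp (tau d n δ) (empProb x S) < P.real S} ≤
      ENNReal.ofReal (δ / 2) := by
  refine measure_union_le_ofReal_half hδ.1
    (measure_exists_empProb_add_lt_le h𝒮 htr hd hn hδ P)
    (measure_exists_add_lt_empProb_le (measurableSet_of_mem_image_compl h𝒮) htr.compl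
      (fun A hA => hd A hA.of_compl) hn hδ P) ?_
  rintro x ⟨S, hS, h⟩
  rcases lt_of_hUp_lt (empProb_mem_Icc x S).2 measureReal_le_one h with h | h
  · exact .inl ⟨S, hS, h⟩
  · refine .inr ⟨Sᶜ, mem_image_of_mem _ hS, ?_⟩
    have hτ := tau_pos (d := d) hn hδ
    have h1 := Real.sqrt_nonneg (tau d n δ * (1 - empProb x S))
    rw [probReal_compl_eq_one_sub (h𝒮 S hS), empProb_compl hn]
    have h2 : √(tau d n δ * (1 - P.real S)) ≤ √(tau d n δ * (1 - empProb x S)) := by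
      gcongr; linarith
    linarith

/-- `h₊` of the true probabilities bounds the empirical ones uniformly. -/
theorem measure_exists_hUp_lt_empProb_le (h𝒮 : ∀ S ∈ 𝒮, MeasurableSet S)
    (htr : TraceMeasurable 𝒮) (hd : ∀ A, Shatters 𝒮 A → A.card ≤ d) (hn : 1 ≤ n)
    (hδ : δ ∈ Ioo (0 : ℝ) 1) (P : Measure X) [IsProbabilityMeasure P] :
    (Measure.pi fun _ : Fin n => P) {x | ∃ S ∈ 𝒮, hUp (tau d n δ) (P.real S) < empProb x S} ≤
      ENNReal.ofReal (δ / 2) := by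
  refine measure_union_le_ofReal_half hδ.1
    (measure_exists_add_lt_empProb_le h𝒮 htr hd hn hδ P)
    (measure_exists_empProb_add_lt_le (measurableSet_of_mem_image_compl h𝒮) htr.compl
      (fun A hA => hd A hA.of_compl) hn hδ P) ?_
  rintro x ⟨S, hS, h⟩
  rcases lt_of_hUp_lt measureReal_le_one (empProb_mem_Icc x S).2 h with h | h
  · exact .inl ⟨S, hS, h⟩
  · refine .inr ⟨Sᶜ, mem_image_of_mem _ hS, ?_⟩
    have hτ := tau_pos (d := d) hn hδ
    have h1 := Real.sqrt_nonneg (tau d n δ * (1 - P.real S))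
    rw [probReal_compl_eq_one_sub (h𝒮 S hS), empProb_compl hn]
    have h2 : √(tau d n δ * (1 - empProb x S)) ≤ √(tau d n δ * (1 - P.real S)) := by
      gcongr; linarith
    linarith

theorem sampleLaw_le (P Q : ProbabilityMeasure X) {A B : Set (Fin n → X)}
    {R : Set ((Fin n → X) × (Fin n → X))} (hδ : 0 < δ)
    (hA : (Measure.pi fun _ => (P : Measure X)) A ≤ ENNReal.ofReal (δ / 2))
    (hB : (Measure.pi fun _ => (Q : Measure X)) B ≤ ENNReal.ofReal (δ / 2))
    (hR : ∀ z ∈ R, z.1 ∈ A ∨ z.2 ∈ B) : sampleLaw n P Q R ≤ ENNReal.ofReal δ := by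
  have hsub : R ⊆ A ×ˢ univ ∪ univ ×ˢ B := fun z hz => by simpa using hR z hz
  refine (measure_mono hsub).trans ((measure_union_le _ _).trans ?_)
  rw [sampleLaw, Measure.prod_prod, Measure.prod_prod, measure_univ, measure_univ, mul_one,
    one_mul]
  refine (add_le_add hA hB).trans_eq ?_
  rw [← ENNReal.ofReal_add (by linarith) (by linarith), add_halves]

end Bands

/-! ### Trade-off functions and likelihood-ratio tests -/

theorem isTest_indicator {X : Type*} [MeasurableSpace X] {S : Set X} (hS : MeasurableSet S) :
    IsTest (S.indicator fun _ => (1 : ℝ)) :=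
  ⟨measurable_const.indicator hS, fun x =>
    ⟨indicator_nonneg (fun _ _ => zero_le_one) x, indicator_le_self' (fun _ _ => zero_le_one) x⟩⟩

theorem IsTest.integrable {X : Type*} [MeasurableSpace X] {φ : X → ℝ} (hφ : IsTest φ)
    (P : Measure X) [IsFiniteMeasure P] : Integrable φ P :=
  Integrable.of_bound hφ.1.aestronglyMeasurable 1 (Filter.Eventually.of_forall fun x => by
    rw [Real.norm_of_nonneg (hφ.2 x).1]; exact (hφ.2 x).2)

theorem tradeoff_le_measureReal_compl {X : Type*} [MeasurableSpace X] (P Q : ProbabilityMeasure X)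
    {S : Set X} (hS : MeasurableSet S) :
    tradeoff P Q ((P : Measure X).real S) ≤ (Q : Measure X).real Sᶜ := by
  refine csInf_le ⟨0, ?_⟩ ⟨S.indicator fun _ => 1, isTest_indicator hS, ?_, ?_⟩
  · rintro _ ⟨φ, hφ, -, rfl⟩
    exact integral_nonneg fun x => sub_nonneg.2 (hφ.2 x).2
  · rw [integral_indicator_const _ hS]; simp
  · rw [integral_sub (integrable_const _) ((isTest_indicator hS).integrable _),
      integral_indicator_const _ hS, probReal_compl_eq_one_sub hS]
    simp

/-- The Neyman–Pearson lemma in Lagrangian form: the level set `{q > l p}` minimizes the type II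
error plus `l` times the type I error. -/
theorem neymanPearson_lagrangian {X : Type*} [MeasurableSpace X] {P Q μ : Measure X}
    [IsProbabilityMeasure P] [IsProbabilityMeasure Q] [IsFiniteMeasure μ] (hP : P ≪ μ)
    (hQ : Q ≪ μ) {l : ℝ} (hl : 0 ≤ l) {S : Set X} (hS : MeasurableSet S)
    (hSl : S =ᵐ[μ] levelSet (P.rnDeriv μ) (Q.rnDeriv μ) (ENNReal.ofReal l)) {φ : X → ℝ}
    (hφ : IsTest φ) :
    Q.real Sᶜ + l * P.real S ≤ ∫ x, (1 - φ x) ∂Q + l * ∫ x, φ x ∂P := by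
  set g : X → ℝ := fun x => S.indicator (fun _ => (1 : ℝ)) x - φ x with hg
  have hgP : Integrable g P := ((isTest_indicator hS).integrable P).sub (hφ.integrable P)
  have hgQ : Integrable g Q := ((isTest_indicator hS).integrable Q).sub (hφ.integrable Q)
  have h0 : 0 ≤ ∫ x, ((Q.rnDeriv μ x).toReal • g x - l * ((P.rnDeriv μ x).toReal • g x)) ∂μ := by
    refine integral_nonneg_of_ae ?_
    filter_upwards [hSl.mem_iff, P.rnDeriv_lt_top μ, Q.rnDeriv_lt_top μ] with x hx hp hq
    have hiff : x ∈ S ↔ l * (P.rnDeriv μ x).toReal < (Q.rnDeriv μ x).toReal := by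
      rw [hx, levelSet, if_neg ENNReal.ofReal_ne_top, mem_ofPred_eq,
        ← ENNReal.toReal_lt_toReal (ENNReal.mul_ne_top ENNReal.ofReal_ne_top hp.ne) hq.ne,
        ENNReal.toReal_mul, ENNReal.toReal_ofReal hl]
    obtain ⟨h1, h2⟩ := hφ.2 x
    simp only [Pi.zero_apply, hg, smul_eq_mul]
    by_cases hxS : x ∈ S
    · have := hiff.1 hxS
      rw [indicator_of_mem hxS]
      nlinarith
    · have := not_lt.1 (mt hiff.2 hxS)
      rw [indicator_of_notMem hxS]
      nlinarith
  rw [integral_sub ((integrable_rnDeriv_smul_iff hQ).2 hgQ)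
    (((integrable_rnDeriv_smul_iff hP).2 hgP).const_mul l), integral_const_mul,
    integral_rnDeriv_smul hQ, integral_rnDeriv_smul hP,
    integral_sub ((isTest_indicator hS).integrable Q) (hφ.integrable Q),
    integral_sub ((isTest_indicator hS).integrable P) (hφ.integrable P),
    integral_indicator_const _ hS, integral_indicator_const _ hS] at h0
  rw [integral_sub (integrable_const _) (hφ.integrable Q), probReal_compl_eq_one_sub hS]
  simp only [smul_eq_mul, mul_one, integral_const, probReal_univ] at h0 ⊢
  linarith

theorem exists_subgradient {s : Set ℝ} {f : ℝ → ℝ} (hf : ConvexOn ℝ s f) {a : ℝ}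
    (ha : a ∈ interior s) : ∃ m, ∀ t ∈ s, f a + m * (t - a) ≤ f t := by
  refine ⟨derivWithin f (Ioi a) a, fun t ht => ?_⟩
  rcases lt_trichotomy t a with h | rfl | h
  · have h1 := (hf.slope_le_leftDeriv_of_mem_interior ht ha h).trans
      (hf.leftDeriv_le_rightDeriv_of_mem_interior ha)
    rw [slope_def_field, div_le_iff₀ (by linarith)] at h1
    linarith
  · simp
  · have h1 := hf.rightDeriv_le_slope_of_mem_interior ha ht h
    rw [slope_def_field, le_div_iff₀ (by linarith)] at h1
    linarith

/-- For an attainable pair, a trade-off curve that falls below a convex function at some point is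
below it already at the errors of a set of the class. Otherwise, with `-l` a subgradient of `f` at
`α`, the Lagrangian optimality of `{q > l p}` would give `T(P,Q)(α) ≥ f α`. -/
theorem Attainable.exists_measureReal_compl_lt {X : Type*} [MeasurableSpace X] {𝒮 : Set (Set X)}
    (h𝒮 : ∀ S ∈ 𝒮, MeasurableSet S) {P Q : ProbabilityMeasure X} (hPQ : Attainable 𝒮 P Q)
    {f : ℝ → ℝ} (hf : IsBenchmark f) {α : ℝ} (hα : α ∈ Icc (0 : ℝ) 1)
    (h : tradeoff P Q α < f α) :
    ∃ S ∈ 𝒮, (Q : Measure X).real Sᶜ < f ((P : Measure X).real S) := by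
  by_contra! hc
  have hint : ∀ a ∈ Ioo (0 : ℝ) 1, ∀ φ : X → ℝ, IsTest φ → ∫ x, φ x ∂(P : Measure X) ≤ a →
      f a ≤ ∫ x, (1 - φ x) ∂(Q : Measure X) := by
    intro a ha φ hφ hφa
    obtain ⟨m, hm⟩ := exists_subgradient hf.convexOn (a := a) (by rwa [interior_Icc])
    have hm0 : m ≤ 0 := by
      have h1 := hm 1 (by simp)
      have h2 := hf.antitoneOn ⟨ha.1.le, ha.2.le⟩ (by simp) ha.2.le
      by_contra! hm0
      nlinarith [mul_pos hm0 (sub_pos.2 ha.2)]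
    obtain ⟨-, -, hlev⟩ := hPQ
    obtain ⟨S, hS, hSl⟩ := hlev (ENNReal.ofReal (-m))
    have : IsFiniteMeasure ((2⁻¹ : ℝ≥0∞) • ((P : Measure X) + (Q : Measure X))) :=
      Measure.smul_finite _ (by simp)
    have hPμ : (P : Measure X) ≪ (2⁻¹ : ℝ≥0∞) • ((P : Measure X) + (Q : Measure X)) :=
      Measure.AbsolutelyContinuous.mk fun s _ hs => by simp at hs; exact hs.1
    have hQμ : (Q : Measure X) ≪ (2⁻¹ : ℝ≥0∞) • ((P : Measure X) + (Q : Measure X)) :=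
      Measure.AbsolutelyContinuous.mk fun s _ hs => by simp at hs; exact hs.2
    have hNP := neymanPearson_lagrangian hPμ hQμ (neg_nonneg.2 hm0) (h𝒮 S hS) hSl hφ
    have h1 := hm ((P : Measure X).real S) ⟨measureReal_nonneg, measureReal_le_one⟩
    have h2 := hc S hS
    nlinarith [mul_nonneg (neg_nonneg.2 hm0) (sub_nonneg.2 hφa)]
  have hne : {β : ℝ | ∃ φ : X → ℝ, IsTest φ ∧ ∫ x, φ x ∂(P : Measure X) ≤ α ∧
      β = ∫ x, (1 - φ x) ∂(Q : Measure X)}.Nonempty :=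
    ⟨_, fun _ => 0, ⟨measurable_const, fun _ => by simp⟩, by simpa using hα.1, rfl⟩
  refine absurd h (not_lt.2 (le_csInf hne ?_))
  rintro _ ⟨φ, hφ, hφα, rfl⟩
  rcases hα.1.eq_or_lt with rfl | h0
  · -- at `0` the slope of `f` may be infinite, so continuity is used instead
    have hcont : Filter.Tendsto f (nhdsWithin 0 (Ioo 0 1)) (nhds (f 0)) :=
      (hf.continuousOn 0 (by simp)).mono_left (nhdsWithin_mono _ Ioo_subset_Icc_self)
    have : (nhdsWithin (0 : ℝ) (Ioo 0 1)).NeBot := by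
      rw [nhdsWithin_Ioo_eq_nhdsGT zero_lt_one]; infer_instance
    exact le_of_tendsto hcont (eventually_nhdsWithin_of_forall fun a ha =>
      hint a ha φ hφ (hφα.trans ha.1.le))
  · rcases hα.2.eq_or_lt with rfl | h1
    · refine (hf.le_one_sub 1 (by simp)).trans ?_
      rw [sub_self]
      exact integral_nonneg fun x => sub_nonneg.2 (hφ.2 x).2
    · exact hint α ⟨h0, h1⟩ φ hφ hφα

end TradeoffTesting

/-! ### Errors of the scan test -/

theorem mainTheorem1 {X : Type*} [MeasurableSpace X] (𝒮 : Set (Set X))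
    (h𝒮 : ∀ S ∈ 𝒮, MeasurableSet S) (htrace : TradeoffTesting.TraceMeasurable 𝒮)
    (hVC : TradeoffTesting.vcDim 𝒮 ≠ ⊤)
    (n : ℕ) (hn : 1 ≤ n) (δ : ℝ) (hδ : δ ∈ Ioo (0 : ℝ) 1)
    (f₀ : ℝ → ℝ) (hf₀ : TradeoffTesting.IsBenchmark f₀) :
    TradeoffTesting.errOne univ f₀ (TradeoffTesting.scanTest 𝒮 f₀ n δ) ≤ ENNReal.ofReal δ ∧
    ∀ f₁ : ℝ → ℝ, TradeoffTesting.IsBenchmark f₁ →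
      (∀ α ∈ Icc (0 : ℝ) 1,
        f₁ α ≤
          (TradeoffTesting.hInv (TradeoffTesting.tau (TradeoffTesting.vcDim 𝒮).toNat n δ) ∘
            TradeoffTesting.hInv (TradeoffTesting.tau (TradeoffTesting.vcDim 𝒮).toNat n δ) ∘
            f₀ ∘
            TradeoffTesting.hUp (TradeoffTesting.tau (TradeoffTesting.vcDim 𝒮).toNat n δ) ∘
            TradeoffTesting.hUp (TradeoffTesting.tau (TradeoffTesting.vcDim 𝒮).toNat n δ)) α) →
      TradeoffTesting.errTwo (TradeoffTesting.attainablePairs 𝒮) f₁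
        (TradeoffTesting.scanTest 𝒮 f₀ n δ) ≤ ENNReal.ofReal δ := by
  set d := (TradeoffTesting.vcDim 𝒮).toNat
  set τ := TradeoffTesting.tau d n δ
  have hd : ∀ A, TradeoffTesting.Shatters 𝒮 A → A.card ≤ d := fun A hA =>
    hA.card_le_toNat_vcDim hVC
  have hdc : ∀ A, TradeoffTesting.Shatters (compl '' 𝒮) A → A.card ≤ d := fun A hA =>
    hd A hA.of_compl
  have h𝒮c := TradeoffTesting.measurableSet_of_mem_image_compl h𝒮
  have hτ : 0 < τ := TradeoffTesting.tau_pos hn hδ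
  have hmono := TradeoffTesting.hUp_monotoneOn hτ
  have hI : ∀ (P : ProbabilityMeasure X) (S : Set X), (P : Measure X).real S ∈ Icc (0 : ℝ) 1 :=
    fun P S => ⟨measureReal_nonneg, measureReal_le_one⟩
  have hhI : ∀ {t : ℝ}, t ∈ Icc (0 : ℝ) 1 → TradeoffTesting.hUp τ t ∈ Icc (0 : ℝ) 1 :=
    fun ht => TradeoffTesting.hUp_mem_Icc hτ.le ht.1
  constructor
  · refine iSup₂_le fun PQ hPQ => ?_
    refine TradeoffTesting.sampleLaw_le PQ.1 PQ.2 hδ.1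
      (TradeoffTesting.measure_exists_hUp_empProb_lt_le h𝒮 htrace hd hn hδ _)
      (TradeoffTesting.measure_exists_hUp_empProb_lt_le h𝒮c htrace.compl hdc hn hδ _) ?_
    rintro ⟨x, y⟩ ⟨S, hS, hlt⟩
    by_contra! hgood
    simp only [mem_ofPred_eq, not_exists, not_and, not_lt] at hgood
    have hP := hgood.1 S hS
    have hQ := hgood.2 Sᶜ (mem_image_of_mem _ hS)
    have h1 := hPQ.2 _ (hI PQ.1 S)
    have h2 := TradeoffTesting.tradeoff_le_measureReal_compl PQ.1 PQ.2 (h𝒮 S hS)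
    have h3 := hf₀.antitoneOn (hI PQ.1 S) (hhI (TradeoffTesting.empProb_mem_Icc x S)) hP
    exact absurd hlt (not_lt.2 (h3.trans (h1.trans (h2.trans hQ))))
  · intro f₁ hf₁ hle
    refine iSup₂_le fun PQ hPQ => ?_
    obtain ⟨hatt, α, hα, hlt⟩ := hPQ
    obtain ⟨S, hS, hSlt⟩ := hatt.exists_measureReal_compl_lt h𝒮 hf₁ hα hlt
    refine TradeoffTesting.sampleLaw_le PQ.1 PQ.2 hδ.1
      (TradeoffTesting.measure_exists_hUp_lt_empProb_le h𝒮 htrace hd hn hδ _)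
      (TradeoffTesting.measure_exists_hUp_lt_empProb_le h𝒮c htrace.compl hdc hn hδ _) ?_
    rintro ⟨x, y⟩ hz
    by_contra! hgood
    simp only [mem_ofPred_eq, not_exists, not_and, not_lt] at hgood
    have hP := hgood.1 S hS
    have hQ := hgood.2 Sᶜ (mem_image_of_mem _ hS)
    refine hz ⟨S, hS, ?_⟩
    have hsep : TradeoffTesting.hUp τ (TradeoffTesting.hUp τ ((PQ.2 : Measure X).real Sᶜ)) <
        f₀ (TradeoffTesting.hUp τ (TradeoffTesting.hUp τ ((PQ.1 : Measure X).real S))) :=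
      TradeoffTesting.hUp_lt_of_lt_hInv (hhI (hI _ _))
        (TradeoffTesting.hUp_lt_of_lt_hInv (hI _ _) (hSlt.trans_le (hle _ (hI _ _))))
    have hx := TradeoffTesting.empProb_mem_Icc x S
    have hy := TradeoffTesting.empProb_mem_Icc y Sᶜ
    exact (hmono hy (hhI (hI _ _)) hQ).trans_lt (hsep.trans_le
      (hf₀.antitoneOn (hhI hx) (hhI (hhI (hI _ _))) (hmono hx (hhI (hI _ _)) hP)))
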